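/- **Theorem.** Fix an integer $d\ge 1$ and a real $c>0$. A GPISE oracle for a $d$-uniform hypergraph $\mathcal H$ takes as input $d$ pairwise disjoint non-empty sets $A_1,\dots,A_d$ of vertices and returns an arbitrary hyperedge $\{u_1,\dots,u_d\}$ of $\mathcal H$ with $u_i\in A_i$ for each $i$, or NULL if there is no such hyperedge. There are a constant $C$, depending only on $d$ and $c$, and a randomized adaptive query algorithm which is given a finite vertex set, an integer $k\ge 1$ and access to a GPISE oracle for an unknown $d$-uniform hypergraph $\mathcal H$ on that vertex set (computation between queries is free), such that, for all vertex sets, all $k$, all $\mathcal H$ and all GPISE oracles for $\mathcal H$, the algorithm always makes at most $C\,k^{2d}\log k$ queries, and with high probability, namely with probability at least $1-k^{-c}$, its output is correct: it outputs a hitting set of $\mathcal H$ (a set of vertices meeting every hyperedge) with at most $k$ vertices if such a set exists, and otherwise reports that no such set exists. -/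

import Mathlib

universe u

/-- A hypergraph is `d`-uniform if each of its hyperedges has exactly `d` vertices. -/
def Hypergraph.IsUniformOfSize {V : Type*} (H : Hypergraph V) (d : ℕ) : Prop :=
  ∀ e ∈ H.edgeSet, e.Finite ∧ e.ncard = d

/-- `S` is a hitting set of `H`: a set of vertices that meets every hyperedge. -/
def Hypergraph.IsHittingSet {V : Type*} (H : Hypergraph V) (S : Set V) : Prop :=
  S ⊆ H.vertexSet ∧ ∀ e ∈ H.edgeSet, (e ∩ S).Nonempty

/-- An input of the GPISE oracle: `d` pairwise disjoint non-empty sets `A₁, …, A_d` of vertices. -/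
structure GPISEQuery (V : Type*) (d : ℕ) where
  /-- the sets `A₁, …, A_d` -/
  part : Fin d → Set V
  nonempty : ∀ i, (part i).Nonempty
  disjoint : ∀ i j, i ≠ j → Disjoint (part i) (part j)

/-- `e` consists of vertices `u₁, …, u_d` with `u_i ∈ A_i` for each `i`. -/
def GPISEQuery.IsTransversal {V : Type*} {d : ℕ} (q : GPISEQuery V d) (e : Set V) : Prop :=
  ∃ u : Fin d → V, (∀ i, u i ∈ q.part i) ∧ e = Set.range u

/-- An answer of the GPISE oracle: a hyperedge, or NULL (which is `none`). -/
abbrev GPISEAnswer (V : Type*) := Option (Set V)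

/-- `O` is a GPISE oracle for `H`: a hyperedge that it returns is a hyperedge of `H` with one vertex
in each of the query sets, and it answers NULL only if there is no such hyperedge. Which one of
several such hyperedges it returns is arbitrary. -/
def Hypergraph.IsGPISEOracle {V : Type*} {d : ℕ} (H : Hypergraph V)
    (O : GPISEQuery V d → GPISEAnswer V) : Prop :=
  ∀ q, (∀ e, O q = some e → e ∈ H.edgeSet ∧ q.IsTransversal e) ∧
    (O q = none → ∀ e ∈ H.edgeSet, ¬ q.IsTransversal e)

/-- A deterministic adaptive query algorithm (decision tree) over the vertex set `V` with output in
`β`: it either stops with an output, or makes a GPISE query and continues depending on the answer.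
Computation between the queries is not charged. -/
inductive QueryAlg (V : Type*) (d : ℕ) (β : Type*) where
  | output (b : β) : QueryAlg V d β
  | query (q : GPISEQuery V d) (next : GPISEAnswer V → QueryAlg V d β) : QueryAlg V d β

/-- The output of the algorithm when its queries are answered by `O`. -/
def QueryAlg.run {V : Type*} {d : ℕ} {β : Type*} (O : GPISEQuery V d → GPISEAnswer V) :
    QueryAlg V d β → β
  | .output b => b
  | .query q next => (next (O q)).run O

/-- The number of queries the algorithm makes when they are answered by `O`. -/
def QueryAlg.numQueries {V : Type*} {d : ℕ} {β : Type*} (O : GPISEQuery V d → GPISEAnswer V) :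
    QueryAlg V d β → ℕ
  | .output _ => 0
  | .query q next => (next (O q)).numQueries O + 1

/-- A randomized query algorithm: a probability distribution on deterministic ones. -/
abbrev RandQueryAlg (V : Type*) (d : ℕ) (β : Type*) := PMF (QueryAlg V d β)

/-- `A` makes at most `B` queries to `O`, whatever its random choices are. -/
def MakesAtMostQueries {V : Type*} {d : ℕ} {β : Type*} (A : RandQueryAlg V d β)
    (O : GPISEQuery V d → GPISEAnswer V) (B : ℝ) : Prop :=
  ∀ t ∈ A.support, (t.numQueries O : ℝ) ≤ B

/-- The probability that the output of `A`, run with the oracle `O`, satisfies `P`. -/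
noncomputable def outputProb {V : Type*} {d : ℕ} {β : Type*} (A : RandQueryAlg V d β)
    (O : GPISEQuery V d → GPISEAnswer V) (P : β → Prop) : ENNReal :=
  A.toOuterMeasure {t | P (t.run O)}

/-- Correct outputs for Hitting-Set on `(H, k)`: a hitting set with at most `k` vertices, or, if
there is none, the report (`none`) that no such set exists. -/
def Hypergraph.IsCorrectHittingSetOutput {V : Type*} (H : Hypergraph V) (k : ℕ) :
    Option (Set V) → Prop
  | some S => H.IsHittingSet S ∧ S.Finite ∧ S.ncard ≤ k
  | none => ¬ ∃ S : Set V, H.IsHittingSet S ∧ S.Finite ∧ S.ncard ≤ k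

/-!
The algorithm keeps a list of hyperedges found so far. In each round it takes a set `S` of at most
`k` vertices that meets all of them, reporting that no hitting set exists if there is no such `S`,
and queries the `d` colour classes of a uniformly random `d`-colouring of the complement of `S`.
If `S` misses a hyperedge `e` of `H`, the colouring gives the vertices of `e` their `d` prescribed
colours with probability at least `p = 1 / d ^ d` (`card_colourings_le`), and then the oracle has to
return a hyperedge, which is new since it misses `S`.

Only few rounds can find a hyperedge: the hyperedges found form a sequence in which each one is
missed by a set of at most `k` vertices that meets all earlier ones, and such a sequence of `d`-sets
has at most `(k + 1) ^ d` members (`IsSkewChain.length_le`). This is a weak form of Bollobás'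
inequality for skew set pairs, with an elementary proof (`IsSkewChain.countP_superset_le`).

So the output is wrong only if the search stops while `S` still misses a hyperedge. Each success
halves a potential that starts at `2 ^ (k + 1) ^ d`, hence `n` rounds fail with probability at most
`2 ^ (k + 1) ^ d * (1 - p / 2) ^ n` (`card_failure_le`), which is below `k ^ (-c)` for `n` of the
order of `k ^ d * log k` (`two_pow_mul_pow_le`). Every round makes at most one query, so that even
`O(k ^ d * log k)` queries suffice.
-/

/-! ### Skew chains -/

/-- A list of sets `e₁ :: e₂ :: …`, newest first, in which every `eᵢ` comes with a set `S` of at most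
`k` vertices that misses `eᵢ` but meets all the older sets of the list. -/
def IsSkewChain {V : Type*} (k : ℕ) : List (Set V) → Prop
  | [] => True
  | e :: l => (∃ S : Finset V, S.card ≤ k ∧ Disjoint (S : Set V) e ∧
      ∀ e' ∈ l, (e' ∩ (S : Set V)).Nonempty) ∧ IsSkewChain k l

/-- A union bound for counting in lists: if every member of `l` that satisfies `p` satisfies one of
the `q s`, there are at most `∑ s, #(q s)` members that satisfy `p`. -/
theorem List.countP_le_sum_countP {α ι : Type*} (s : Finset ι) (p : α → Bool) (q : ι → α → Bool)
    (l : List α) (h : ∀ a ∈ l, p a → ∃ i ∈ s, q i a) :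
    l.countP p ≤ ∑ i ∈ s, l.countP (q i) := by
  induction l with
  | nil => simp
  | cons a l ih =>
    have ih' := ih fun b hb => h b (List.mem_cons_of_mem a hb)
    simp only [List.countP_cons, Finset.sum_add_distrib]
    refine add_le_add ih' ?_
    by_cases hp : p a
    · obtain ⟨i, hi, hq⟩ := h a List.mem_cons_self hp
      calc (if p a = true then 1 else 0) = (if q i a = true then 1 else 0) := by simp [hp, hq]
        _ ≤ ∑ i ∈ s, (if q i a = true then 1 else 0) :=
          Finset.single_le_sum (f := fun i => if q i a = true then 1 else 0)
            (fun _ _ => Nat.zero_le _) hi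
    · simp [hp]

open Classical in
/-- In a skew chain of `d`-sets, at most `(k + 1) ^ r` members contain a given set `T` of `d - r`
vertices. The set `S` that misses the newest member containing `T` is disjoint from `T`, so each
older member containing `T` also contains `insert s T` for one of the at most `k` elements `s` of
`S`; this gives the recursion `1 + k * (k + 1) ^ r ≤ (k + 1) ^ (r + 1)`. -/
theorem IsSkewChain.countP_superset_le {V : Type*} [Finite V] {k d : ℕ} (r : ℕ) (T : Finset V)
    (hT : T.card + r = d) (l : List (Set V)) (hl : IsSkewChain k l)
    (hd : ∀ e ∈ l, e.ncard = d) :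
    l.countP (fun e => (T : Set V) ⊆ e) ≤ (k + 1) ^ r := by
  induction r generalizing T l with
  | zero =>
    induction l with
    | nil => simp
    | cons e l ih =>
      have ih' := ih hl.2 fun e' he' => hd e' (List.mem_cons_of_mem e he')
      by_cases hTe : (T : Set V) ⊆ e
      · obtain ⟨S, -, hSe, hS⟩ := hl.1
        have eq_T : ∀ e' ∈ e :: l, (T : Set V) ⊆ e' → (T : Set V) = e' := fun e' he' h =>
          Set.eq_of_subset_of_ncard_le h
            (by rw [hd e' he', Set.ncard_coe_finset]; omega) (Set.toFinite _)
        have h0 : l.countP (fun e => (T : Set V) ⊆ e) = 0 := by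
          rw [List.countP_eq_zero]
          intro e' he' h
          have h1 := eq_T e' (List.mem_cons_of_mem e he') (by simpa using h)
          have h2 := eq_T e List.mem_cons_self hTe
          obtain ⟨v, hv, hvS⟩ := hS e' he'
          exact Set.disjoint_left.1 hSe hvS (h2 ▸ h1 ▸ hv)
        simp [hTe, h0]
      · simpa [List.countP_cons, hTe] using ih'
  | succ r ihr =>
    induction l with
    | nil => simp
    | cons e l ih =>
      have hd' : ∀ e' ∈ l, e'.ncard = d := fun e' he' => hd e' (List.mem_cons_of_mem e he')
      by_cases hTe : (T : Set V) ⊆ e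
      · obtain ⟨S, hSk, hSe, hS⟩ := hl.1
        have hST : ∀ s ∈ S, s ∉ T := fun s hs hsT => Set.disjoint_left.1 hSe hs (hTe hsT)
        have key : l.countP (fun e => (T : Set V) ⊆ e) ≤ k * (k + 1) ^ r :=
          calc l.countP (fun e => (T : Set V) ⊆ e)
              ≤ ∑ s ∈ S, l.countP (fun e => ((insert s T : Finset V) : Set V) ⊆ e) := by
                refine List.countP_le_sum_countP S _ _ l fun e' he' h => ?_
                obtain ⟨s, hse, hsS⟩ := hS e' he'
                refine ⟨s, hsS, ?_⟩
                simpa [Set.insert_subset_iff, hse] using h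
            _ ≤ ∑ s ∈ S, (k + 1) ^ r := Finset.sum_le_sum fun s hs =>
                ihr (insert s T) (by rw [Finset.card_insert_of_notMem (hST s hs)]; omega) l hl.2 hd'
            _ ≤ k * (k + 1) ^ r := by
                rw [Finset.sum_const, smul_eq_mul]
                exact Nat.mul_le_mul_right _ hSk
        have h1 : 1 ≤ (k + 1) ^ r := Nat.one_le_pow _ _ (Nat.succ_pos k)
        have h2 : (k + 1) ^ (r + 1) = k * (k + 1) ^ r + (k + 1) ^ r := by ring
        rw [List.countP_cons]
        split_ifs <;> omega
      · simpa [List.countP_cons, hTe] using ih hl.2 hd'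

theorem IsSkewChain.length_le {V : Type*} [Finite V] {k d : ℕ} {l : List (Set V)}
    (hl : IsSkewChain k l) (hd : ∀ e ∈ l, e.ncard = d) : l.length ≤ (k + 1) ^ d := by
  classical
  simpa using hl.countP_superset_le d ∅ (by simp) l hd

/-! ### The algorithm -/

open Classical in
/-- Some set of at most `k` vertices that meets every member of `l`, or `none` if there is none. -/
noncomputable def smallHittingSet {V : Type*} (k : ℕ) (l : List (Set V)) : Option (Finset V) :=
  if h : ∃ S : Finset V, S.card ≤ k ∧ ∀ e ∈ l, (e ∩ (S : Set V)).Nonempty then some h.choose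
  else none

theorem smallHittingSet_eq_some {V : Type*} {k : ℕ} {l : List (Set V)} {S : Finset V}
    (h : smallHittingSet k l = some S) :
    S.card ≤ k ∧ ∀ e ∈ l, (e ∩ (S : Set V)).Nonempty := by
  unfold smallHittingSet at h
  split_ifs at h with hex
  cases h
  exact hex.choose_spec

theorem smallHittingSet_eq_none {V : Type*} {k : ℕ} {l : List (Set V)}
    (h : smallHittingSet k l = none) (S : Finset V) (hS : S.card ≤ k) :
    ∃ e ∈ l, ¬ (e ∩ (S : Set V)).Nonempty := by
  unfold smallHittingSet at h
  split_ifs at h with hex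
  push Not at hex
  simpa [Set.not_nonempty_iff_eq_empty] using hex S hS

/-- The query whose parts are the colour classes of `χ` outside `S`. -/
def colourQuery {V : Type*} {d : ℕ} (χ : V → Fin d) (S : Finset V)
    (h : ∀ i, ∃ v, v ∉ S ∧ χ v = i) : GPISEQuery V d where
  part i := {v | v ∉ S ∧ χ v = i}
  nonempty := h
  disjoint _ _ hij := Set.disjoint_left.2 fun _ hv hv' => hij (hv.2.symm.trans hv'.2)

open Classical in
/-- The search with the colourings `f 0, f 1, …`, where `l` is the list of hyperedges found so far.
Each round takes a small set `S` meeting all of `l` and looks for a hyperedge that avoids `S` and is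
rainbow in the next colouring; a colouring with an empty colour class outside `S` is skipped. -/
noncomputable def hittingSetSearch {V : Type*} {d : ℕ} (k : ℕ) :
    (n : ℕ) → (Fin n → V → Fin d) → List (Set V) → QueryAlg V d (Option (Set V))
  | 0, _, l => .output ((smallHittingSet k l).map fun S => (S : Set V))
  | n + 1, f, l =>
    match smallHittingSet k l with
    | none => .output none
    | some S =>
      if h : ∀ i, ∃ v, v ∉ S ∧ f 0 v = i then
        .query (colourQuery (f 0) S h) fun a => hittingSetSearch k n (Fin.tail f) (a.toList ++ l)
      else hittingSetSearch k n (Fin.tail f) l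

theorem numQueries_hittingSetSearch_le {V : Type*} {d : ℕ} (k : ℕ)
    (O : GPISEQuery V d → GPISEAnswer V) (n : ℕ) (f : Fin n → V → Fin d) (l : List (Set V)) :
    (hittingSetSearch k n f l).numQueries O ≤ n := by
  induction n generalizing l with
  | zero => simp [hittingSetSearch, QueryAlg.numQueries]
  | succ n ih =>
    unfold hittingSetSearch
    split
    · simp [QueryAlg.numQueries]
    · split_ifs
      · exact Nat.succ_le_succ (ih _ _)
      · exact (ih _ _).trans n.le_succ

/-! ### One round of the search -/

theorem Hypergraph.IsGPISEOracle.of_colourQuery {V : Type*} {d : ℕ} {H : Hypergraph V}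
    {O : GPISEQuery V d → GPISEAnswer V} (hO : H.IsGPISEOracle O) {χ : V → Fin d} {S : Finset V}
    {h : ∀ i, ∃ v, v ∉ S ∧ χ v = i} {e : Set V} (he : O (colourQuery χ S h) = some e) :
    e ∈ H.edgeSet ∧ Disjoint (S : Set V) e := by
  obtain ⟨heH, u, hu, rfl⟩ := (hO _).1 e he
  refine ⟨heH, Set.disjoint_right.2 ?_⟩
  rintro _ ⟨i, rfl⟩
  exact (hu i).1

/-- Once no set of `k` vertices meets all the hyperedges found, or the chosen set meets all
hyperedges of `H`, the output is correct whatever the remaining colourings are. -/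
theorem run_hittingSetSearch_of_settled {V : Type*} [Finite V] {d k : ℕ} {H : Hypergraph V}
    {O : GPISEQuery V d → GPISEAnswer V} (hO : H.IsGPISEOracle O)
    {l : List (Set V)} (hlH : ∀ e ∈ l, e ∈ H.edgeSet)
    (hs : ∀ S, smallHittingSet k l = some S → H.IsHittingSet S)
    (n : ℕ) (f : Fin n → V → Fin d) :
    H.IsCorrectHittingSetOutput k ((hittingSetSearch k n f l).run O) := by
  have hnone : smallHittingSet k l = none → H.IsCorrectHittingSetOutput k none := by
    rintro h ⟨S, hS, hfin, hcard⟩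
    obtain ⟨e, hel, he⟩ := smallHittingSet_eq_none h hfin.toFinset
      (by rwa [← Set.ncard_eq_toFinset_card S hfin])
    rw [hfin.coe_toFinset] at he
    exact he (hS.2 e (hlH e hel))
  induction n with
  | zero =>
    cases h : smallHittingSet k l with
    | none => simpa [hittingSetSearch, QueryAlg.run, h] using hnone h
    | some S =>
      have hS : H.IsCorrectHittingSetOutput k (some (S : Set V)) :=
        ⟨hs S h, S.finite_toSet, by
          rw [Set.ncard_coe_finset]; exact (smallHittingSet_eq_some h).1⟩
      simpa [hittingSetSearch, QueryAlg.run, h] using hS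
  | succ n ih =>
    unfold hittingSetSearch
    split
    next h => exact hnone h
    next S h =>
      split_ifs with hχ
      · have hq : O (colourQuery (f 0) S hχ) = none := by
          by_contra hne
          obtain ⟨e, he⟩ := Option.ne_none_iff_exists'.1 hne
          obtain ⟨heH, hdis⟩ := hO.of_colourQuery he
          obtain ⟨v, hv, hvS⟩ := (hs S h).2 e heH
          exact Set.disjoint_left.1 hdis hvS hv
        simp only [QueryAlg.run, hq, Option.toList_none, List.nil_append]
        exact ih _
      · exact ih _

/-- A round either leaves the list as it is, or prolongs the chain by a hyperedge, and it does the
latter if each vertex `u i` of a hyperedge missed by the chosen set has colour `i`. -/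
theorem run_hittingSetSearch_succ {V : Type*} {d k : ℕ} {H : Hypergraph V}
    {O : GPISEQuery V d → GPISEAnswer V} (hO : H.IsGPISEOracle O) {l : List (Set V)}
    (hl : IsSkewChain k l) {S : Finset V} (hS : smallHittingSet k l = some S)
    {u : Fin d → V} (hu : Set.range u ∈ H.edgeSet) (huS : ∀ i, u i ∉ S) {n : ℕ} (χ : V → Fin d) :
    (∃ e ∈ H.edgeSet, IsSkewChain k (e :: l) ∧ ∀ f : Fin n → V → Fin d,
      (hittingSetSearch k (n + 1) (Fin.cons χ f) l).run O =
        (hittingSetSearch k n f (e :: l)).run O) ∨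
    ((¬ ∀ i, χ (u i) = i) ∧ ∀ f : Fin n → V → Fin d,
      (hittingSetSearch k (n + 1) (Fin.cons χ f) l).run O =
        (hittingSetSearch k n f l).run O) := by
  by_cases hχ : ∀ i, ∃ v, v ∉ S ∧ χ v = i
  · have hrun : ∀ f : Fin n → V → Fin d,
        (hittingSetSearch k (n + 1) (Fin.cons χ f) l).run O =
          (hittingSetSearch k n f ((O (colourQuery χ S hχ)).toList ++ l)).run O := by
      intro f
      rw [hittingSetSearch, hS]
      simp [hχ, QueryAlg.run]
    cases ha : O (colourQuery χ S hχ) with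
    | none =>
      refine Or.inr ⟨fun hrb => ?_, fun f => by simpa [ha] using hrun f⟩
      exact (hO _).2 ha _ hu ⟨u, fun i => ⟨huS i, hrb i⟩, rfl⟩
    | some e =>
      obtain ⟨heH, hdis⟩ := hO.of_colourQuery ha
      obtain ⟨hSk, hSl⟩ := smallHittingSet_eq_some hS
      exact Or.inl ⟨e, heH, ⟨⟨S, hSk, hdis, hSl⟩, hl⟩, fun f => by simpa [ha] using hrun f⟩
  · refine Or.inr ⟨fun hrb => hχ fun i => ⟨u i, huS i, hrb i⟩, fun f => ?_⟩
    rw [hittingSetSearch, hS]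
    simp [hχ]

/-! ### The failure probability -/

/-- A uniform colouring takes prescribed colours on `d` distinct vertices with probability at least
`1 / d ^ d`: recolouring these vertices is a map that is at most `d ^ d` to one. -/
theorem card_colourings_le {V : Type*} [Fintype V] [DecidableEq V] {d : ℕ} {u : Fin d → V}
    (hu : Function.Injective u) :
    Fintype.card (V → Fin d) ≤
      (Finset.univ.filter fun χ : V → Fin d => ∀ i, χ (u i) = i).card * d ^ d := by
  have hmaps : ∀ χ : V → Fin d, ∀ i, Function.extend u id χ (u i) = i := fun χ i => by
    rw [hu.extend_apply]; rfl
  have hinj : Function.Injective fun χ : V → Fin d =>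
      ((⟨Function.extend u id χ, hmaps χ⟩ : {χ : V → Fin d // ∀ i, χ (u i) = i}), χ ∘ u) := by
    intro χ χ' h
    obtain ⟨h1, h2⟩ := Prod.ext_iff.1 h
    have h1 := congrArg Subtype.val h1
    funext v
    by_cases hv : ∃ i, u i = v
    · obtain ⟨i, rfl⟩ := hv
      exact congrFun h2 i
    · have := congrFun h1 v
      simpa [Function.extend_apply' _ _ _ hv] using this
  have := Fintype.card_le_of_injective _ hinj
  rw [Fintype.card_prod, Fintype.card_subtype] at this
  simpa using this

theorem card_filter_cons {X : Type*} [Fintype X] {n : ℕ} (P : (Fin (n + 1) → X) → Prop)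
    [DecidablePred P] :
    (Finset.univ.filter P).card =
      ∑ x, (Finset.univ.filter fun f : Fin n → X => P (Fin.cons x f)).card := by
  simp only [Finset.card_filter]
  rw [← (Fin.consEquiv fun _ => X).sum_comp, Fintype.sum_prod_type]
  rfl

open Classical in
/-- From a chain `l`, at most the fraction `2 ^ ((k + 1) ^ d - l.length) * (1 - 1 / (2 * d ^ d)) ^ n`
of all choices of `n` colourings leads to a wrong output. In a round where the chosen set misses a
hyperedge, a fraction of at least `p = 1 / d ^ d` of the colourings prolongs the chain and so halves
the first factor, and `p * (1 / 2) + (1 - p) = 1 - p / 2`. -/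
theorem card_failure_le {V : Type*} [Fintype V] {d k : ℕ} (hd : 1 ≤ d) {H : Hypergraph V}
    (hV : H.vertexSet = Set.univ) (hH : H.IsUniformOfSize d)
    {O : GPISEQuery V d → GPISEAnswer V} (hO : H.IsGPISEOracle O) (n : ℕ)
    {l : List (Set V)} (hl : IsSkewChain k l) (hlH : ∀ e ∈ l, e ∈ H.edgeSet) :
    ((Finset.univ.filter fun f : Fin n → V → Fin d =>
      ¬ H.IsCorrectHittingSetOutput k ((hittingSetSearch k n f l).run O)).card : ℝ) ≤
      2 ^ ((k + 1) ^ d - l.length) *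
        ((1 - 1 / (2 * (d : ℝ) ^ d)) * Fintype.card (V → Fin d)) ^ n := by
  have hdd : (1 : ℝ) ≤ (d : ℝ) ^ d := one_le_pow₀ (by exact_mod_cast hd)
  have hq : 0 ≤ 1 - 1 / (2 * (d : ℝ) ^ d) := by
    rw [sub_nonneg, div_le_one (by positivity)]; linarith
  induction n generalizing l with
  | zero =>
    rw [pow_zero, mul_one]
    refine le_trans ?_ (one_le_pow₀ one_le_two)
    exact_mod_cast (Finset.card_le_univ _).trans (by simp)
  | succ n ih =>
    by_cases hs : ∀ S, smallHittingSet k l = some S → H.IsHittingSet S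
    · rw [Finset.filter_false_of_mem fun f _ => not_not.2
        (run_hittingSetSearch_of_settled hO hlH hs (n + 1) f)]
      simp only [Finset.card_empty, Nat.cast_zero]
      positivity
    push Not at hs
    obtain ⟨S, hS, hmiss⟩ := hs
    obtain ⟨e, he, heS⟩ : ∃ e ∈ H.edgeSet, ¬ (e ∩ (S : Set V)).Nonempty := by
      by_contra! hcon
      exact hmiss ⟨by simp [hV], hcon⟩
    obtain ⟨u, hu, rfl⟩ : ∃ u : Fin d → V, Function.Injective u ∧ Set.range u = e := by
      have hcard : Fintype.card e = d := by
        rw [← Nat.card_eq_fintype_card]; exact (hH e he).2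
      let φ := (Fintype.equivFinOfCardEq hcard).symm
      refine ⟨fun i => φ i, Subtype.val_injective.comp φ.injective, ?_⟩
      rw [show (fun i => (φ i : V)) = Subtype.val ∘ φ from rfl, φ.surjective.range_comp]
      simp
    have huS : ∀ i, u i ∉ S := fun i hi => heS ⟨u i, ⟨i, rfl⟩, hi⟩
    set N : ℝ := (Fintype.card (V → Fin d) : ℝ) with hN
    set q : ℝ := 1 - 1 / (2 * (d : ℝ) ^ d) with hqdef
    set a : ℝ := 2 ^ ((k + 1) ^ d - l.length) * (q * N) ^ n with ha
    have ha0 : 0 ≤ a := by positivity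
    have hround : ∀ χ : V → Fin d,
        ((Finset.univ.filter fun f : Fin n → V → Fin d => ¬ H.IsCorrectHittingSetOutput k
          ((hittingSetSearch k (n + 1) (Fin.cons χ f) l).run O)).card : ℝ) ≤
        a - if ∀ i, χ (u i) = i then a / 2 else 0 := by
      intro χ
      rcases run_hittingSetSearch_succ hO hl hS he huS (n := n) χ with
        ⟨e', he'H, hchain, hrun⟩ | ⟨hrb, hrun⟩
      · simp only [hrun]
        have hmem : ∀ e ∈ e' :: l, e ∈ H.edgeSet := by
          simpa using And.intro he'H hlH
        have hlen : l.length + 1 ≤ (k + 1) ^ d :=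
          hchain.length_le fun e he => (hH e (hmem e he)).2
        have hhalf : 2 ^ ((k + 1) ^ d - (e' :: l).length) * (q * N) ^ n = a / 2 := by
          rw [ha, show (k + 1) ^ d - l.length = (k + 1) ^ d - (e' :: l).length + 1 by
            rw [List.length_cons]; omega, pow_succ]
          ring
        refine (ih hchain hmem).trans ?_
        rw [hhalf]
        split_ifs <;> linarith
      · simp only [hrun, hrb, if_false, sub_zero]
        exact ih hl hlH
    have hgood : N ≤ (Finset.univ.filter fun χ : V → Fin d => ∀ i, χ (u i) = i).card *
        (d : ℝ) ^ d := by
      rw [hN]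
      exact_mod_cast card_colourings_le hu
    rw [card_filter_cons, Nat.cast_sum]
    refine (Finset.sum_le_sum fun χ _ => hround χ).trans ?_
    rw [Finset.sum_sub_distrib, ← Finset.sum_filter, Finset.sum_const, Finset.sum_const,
      nsmul_eq_mul, nsmul_eq_mul, Finset.card_univ, ← hN, pow_succ (q * N), ← mul_assoc (2 ^ _),
      ← ha]
    have : N / (d : ℝ) ^ d ≤
        (Finset.univ.filter fun χ : V → Fin d => ∀ i, χ (u i) = i).card :=
      (div_le_iff₀ (by positivity)).2 hgood
    calc _ ≤ N * a - N / (d : ℝ) ^ d * (a / 2) := by gcongr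
      _ = a * (q * N) := by rw [hqdef]; field_simp

/-- The failure bound after `N` rounds, `N` of the order of `k ^ d * log k`. In the constant, `2 ^ d`
pays for the `(k + 1) ^ d ≤ 2 ^ d * k ^ d` rounds that may find a hyperedge, `c` for the error
`k ^ (-c)`, and the final `2` for the rounding of `N`. -/
theorem two_pow_mul_pow_le {d : ℕ} (hd : 1 ≤ d) {c : ℝ} (hc : 0 < c) {k N : ℕ} (hk : 2 ≤ k)
    (hN : (2 * (d : ℝ) ^ d * (2 ^ d + c) + 2) * ((k : ℝ) ^ d * Real.log k) < N + 1) :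
    (2 : ℝ) ^ ((k + 1) ^ d) * (1 - 1 / (2 * (d : ℝ) ^ d)) ^ N ≤ 1 / (k : ℝ) ^ c := by
  have hdd : (1 : ℝ) ≤ (d : ℝ) ^ d := one_le_pow₀ (by exact_mod_cast hd)
  have hq : 0 ≤ 1 - 1 / (2 * (d : ℝ) ^ d) := by
    rw [sub_nonneg, div_le_one (by positivity)]; linarith
  have hk2 : (2 : ℝ) ≤ k := by exact_mod_cast hk
  have hk0 : (0 : ℝ) < k := by linarith
  have hlog : Real.log 2 ≤ Real.log k := Real.log_le_log two_pos hk2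
  have hlog2 := Real.log_two_gt_d9
  have hL : 0 < Real.log k := by linarith
  have hK : (1 : ℝ) ≤ (k : ℝ) ^ d := one_le_pow₀ (by linarith)
  have hM : ((k : ℝ) + 1) ^ d ≤ 2 ^ d * (k : ℝ) ^ d := by
    rw [← mul_pow]; gcongr; linarith
  have hKL : Real.log k ≤ (k : ℝ) ^ d * Real.log k := le_mul_of_one_le_left hL.le hK
  have hML : ((k : ℝ) + 1) ^ d * Real.log 2 ≤ 2 ^ d * ((k : ℝ) ^ d * Real.log k) := by
    rw [← mul_assoc]; gcongr
  have hcL : c * Real.log k ≤ c * ((k : ℝ) ^ d * Real.log k) := by gcongr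
  have hexp : ((k : ℝ) + 1) ^ d * Real.log 2 + c * Real.log k ≤ N / (2 * (d : ℝ) ^ d) := by
    rw [le_div_iff₀ (by positivity)]
    have := mul_le_mul_of_nonneg_right (add_le_add hML hcL)
      (show 0 ≤ 2 * (d : ℝ) ^ d by positivity)
    nlinarith
  have h2 : (2 : ℝ) ^ ((k + 1) ^ d) = Real.exp (((k : ℝ) + 1) ^ d * Real.log 2) := by
    rw [mul_comm, Real.exp_mul, Real.exp_log two_pos]
    exact_mod_cast (Real.rpow_natCast 2 ((k + 1) ^ d)).symm
  have h3 : (1 - 1 / (2 * (d : ℝ) ^ d)) ^ N ≤ Real.exp (-(N / (2 * (d : ℝ) ^ d))) := by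
    refine (pow_le_pow_left₀ hq (Real.one_sub_le_exp_neg _) N).trans_eq ?_
    rw [← Real.exp_nat_mul]
    congr 1
    ring
  rw [h2, one_div ((k : ℝ) ^ c), ← Real.rpow_neg hk0.le, Real.rpow_def_of_pos hk0]
  refine (mul_le_mul_of_nonneg_left h3 (Real.exp_pos _).le).trans ?_
  rw [← Real.exp_add, Real.exp_le_exp]
  linarith

open Classical in
/-- A uniform choice among the algorithms `t x` succeeds with probability at least `1 - ε` if a
fraction of at most `ε` of them fails. -/
theorem outputProb_map_uniform {V X : Type*} [Fintype X] [Nonempty X] {d : ℕ} {β : Type*}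
    (t : X → QueryAlg V d β) (O : GPISEQuery V d → GPISEAnswer V) (P : β → Prop) {ε : ℝ}
    (h : ((Finset.univ.filter fun x => ¬ P ((t x).run O)).card : ℝ) ≤ ε * Fintype.card X) :
    ENNReal.ofReal (1 - ε) ≤ outputProb ((PMF.uniformOfFintype X).map t) O P := by
  have hX : (0 : ℝ) < Fintype.card X := by exact_mod_cast Fintype.card_pos
  have hsum := Finset.card_filter_add_card_filter_not (s := (Finset.univ : Finset X))
    (fun x => P ((t x).run O))
  have hsum' : ((Finset.univ.filter fun x => P ((t x).run O)).card : ℝ) +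
      (Finset.univ.filter fun x => ¬ P ((t x).run O)).card = Fintype.card X := by
    exact_mod_cast hsum
  rw [outputProb, PMF.toOuterMeasure_map_apply, PMF.toOuterMeasure_uniformOfFintype_apply,
    Fintype.card_ofFinset, ← ENNReal.ofReal_natCast, ← ENNReal.ofReal_natCast (Fintype.card X),
    ← ENNReal.ofReal_div_of_pos hX]
  refine ENNReal.ofReal_le_ofReal ?_
  rw [le_div_iff₀ hX]
  simp only [Set.mem_preimage, Set.mem_ofPred_eq]
  linarith

theorem mainTheorem1 (d : ℕ) (hd : 1 ≤ d) (c : ℝ) (hc : 0 < c) :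
    ∃ (C : ℝ) (A : ∀ (V : Type u) [Finite V], ℕ → RandQueryAlg V d (Option (Set V))),
      ∀ (V : Type u) [Finite V] (k : ℕ), 1 ≤ k →
        ∀ H : Hypergraph V, H.vertexSet = Set.univ → H.IsUniformOfSize d →
          ∀ O : GPISEQuery V d → GPISEAnswer V, H.IsGPISEOracle O →
            MakesAtMostQueries (A V k) O (C * ((k : ℝ) ^ (2 * d) * Real.log k)) ∧
              ENNReal.ofReal (1 - 1 / (k : ℝ) ^ c) ≤
                outputProb (A V k) O (H.IsCorrectHittingSetOutput k) := by
  classical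
  have : NeZero d := ⟨by omega⟩
  let C : ℝ := 2 * (d : ℝ) ^ d * (2 ^ d + c) + 2
  let N : ℕ → ℕ := fun k => ⌊C * ((k : ℝ) ^ d * Real.log k)⌋₊
  refine ⟨C, fun V _ k =>
    letI := Fintype.ofFinite V
    (PMF.uniformOfFintype (Fin (N k) → V → Fin d)).map fun f => hittingSetSearch k (N k) f [], ?_⟩
  intro V _ k hk H hV hH O hO
  let _ := Fintype.ofFinite V
  have hk1 : (1 : ℝ) ≤ k := by exact_mod_cast hk
  have hlog : 0 ≤ Real.log k := Real.log_nonneg hk1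
  have hC : 0 ≤ C := by positivity
  refine ⟨fun t ht => ?_, ?_⟩
  · obtain ⟨f, -, rfl⟩ := (PMF.mem_support_map_iff _ _ _).1 ht
    calc _ ≤ (N k : ℝ) := by exact_mod_cast numQueries_hittingSetSearch_le k O (N k) f []
      _ ≤ C * ((k : ℝ) ^ d * Real.log k) := Nat.floor_le (by positivity)
      _ ≤ C * ((k : ℝ) ^ (2 * d) * Real.log k) := by gcongr; omega
  · -- For `k = 1` there are no rounds, and nothing is claimed about the output.
    rcases hk.eq_or_lt with rfl | hk2
    · simp
    refine outputProb_map_uniform _ O _ ?_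
    refine (card_failure_le hd hV hH hO (N k) (l := []) trivial (by simp)).trans ?_
    rw [mul_pow, ← mul_assoc, List.length_nil, Nat.sub_zero, Fintype.card_fun (α := Fin (N k)),
      Fintype.card_fin (N k), Nat.cast_pow]
    exact mul_le_mul_of_nonneg_right
      (two_pow_mul_pow_le hd hc hk2 (Nat.lt_floor_add_one _)) (by positivity)
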